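/- Let $[n]=\{1,\dots,n\}$ and let $B$ be a building set on $[n]$: a collection of nonempty subsets of $[n]$ that contains all singletons $\{i\}$, $i\in[n]$, and such that $I\cup J\in B$ whenever $I,J\in B$ and $I\cap J\ne\emptyset$. Let $B_{\max}$ be the set of inclusion-maximal elements of $B$; $B$ is connected if $[n]\in B$, and then $B_{\max}=\{[n]\}$. For $I\subseteq[n]$ put $\mu(B|_I)=\#\{J\in B: J\subseteq I\}$. The nestohedron of $B$ is the Minkowski sum $P_B=\sum_{I\in B}\mathrm{Conv}\{e_i: i\in I\}\subset\mathbb{R}^n$. For a function $f:[n]\to\{1,2,\dots\}$ write $\mathbf{x}_f=x_{f(1)}\cdots x_{f(n)}$. The function $f$ is $P_B$-generic if it lies in the interior of the normal cone $\{g:\ \langle g,x\rangle\le\langle g,v\rangle \text{ for all } x\in P_B\}$ of $P_B$ at some vertex $v$. Let $F(P_B)=\sum_{f}\mathbf{x}_f$, the sum over all $P_B$-generic $f$. For a vertex $v$ of $P_B$ let $N_v$ be the set of all $I\in B\setminus B_{\max}$ such that $v$ lies on the facet $F_I=P_B\cap\{x:\sum_{i\in I}x_i=\mu(B|_I)\}$.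 For $I\in N_v\cup B_{\max}$ let $i_I$ be the element with $\{i_I\}=I\setminus\bigcup\{J\in N_v: J\subsetneq I\}$, let $P_v$ be the poset on $[n]$ with $i_I\le_v i_J$ if and only if $I\subseteq J$, and let the $B$-tree $T_v$ be the Hasse diagram of $P_v$, with an edge $i\to j$ for each covering relation $i\lessdot j$. A nested set is a subset $N$ of $B\setminus B_{\max}$ such that any two elements of $N$ are comparable or disjoint and no union of two or more pairwise disjoint elements of $N$ belongs to $B$. For a finite digraph $T$ on a vertex set $V$, a $T$-partition is a function $f:V\to\{1,2,\dots\}$ with $f(a)<f(b)$ for every edge $a\to b$ of $T$, and $F(T)=\sum_f\mathbf{x}_f$ with $\mathbf{x}_f=\prod_{a\in V}x_{f(a)}$, the sum over all $T$-partitions $f$; it depends only on the isomorphism class of $T$. Let $T(B)$ be the multiset of the isomorphism classes of the $T_v$, $v$ running over the vertices of $P_B$. Theorem. For every building set $B$ and every vertex $v$ of $P_B$, the set $N_v$ is an (inclusion-)maximal nested set, $P_v$ is a partial order, and $T_v$ is a rooted forest with edges directed towards the roots, and a rooted tree if $B$ is connected. Moreover $$F(P_B)=\sum_{v}F(T_v)=\sum_{T\in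 T(B)}F(T),$$ where $v$ runs over the vertices of $P_B$. Consequently $F(P_B)$ depends only on the multiset $T(B)$: if $B$ and $C$ are building sets with $T(B)=T(C)$, then $F(P_B)=F(P_C)$. -/

import Mathlib

open scoped Pointwise

namespace Nestohedra

/-! ### Enumerators in the variables `x₁, x₂, …` -/

/-- The exponent vector of the monomial `x_f = ∏ v, x_{f v}`. -/
noncomputable def expo {V : Type*} [Fintype V] (f : V → ℕ+) : ℕ+ →₀ ℕ :=
  ∑ v, Finsupp.single (f v) 1

/-- Only finitely many functions `f` have a given monomial `x_f`, so that the coefficients of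
`enumerator` below are honest cardinalities. -/
theorem finite_expo_eq {V : Type*} [Fintype V] (d : ℕ+ →₀ ℕ) :
    {f : V → ℕ+ | expo f = d}.Finite := by
  classical
  refine (Set.Finite.pi (t := fun _ : V => (d.support : Set ℕ+))
    (fun _ => d.support.finite_toSet)).subset ?_
  intro f hf v _
  have hf' : expo f = d := hf
  have h : 1 ≤ expo f (f v) := by
    unfold expo
    rw [Finsupp.finsetSum_apply]
    calc (1 : ℕ) = (Finsupp.single (f v) 1 : ℕ+ →₀ ℕ) (f v) := by simp
      _ ≤ _ := Finset.single_le_sum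
          (f := fun w => (Finsupp.single (f w) 1 : ℕ+ →₀ ℕ) (f v))
          (fun _ _ => Nat.zero_le _) (Finset.mem_univ v)
  rw [hf'] at h
  simp only [Finset.mem_coe, Finsupp.mem_support_iff]
  omega

/-- The formal power series `∑_{f ∈ S} x_f`: its coefficient at `x^d` is the number of `f ∈ S`
with `x_f = x^d`. -/
noncomputable def enumerator {V : Type*} [Fintype V] (S : Set (V → ℕ+)) :
    MvPowerSeries ℕ+ ℤ :=
  fun d => (({f | f ∈ S ∧ expo f = d}.ncard : ℕ) : ℤ)

/-! ### The lattice point enumerator of a polytope -/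

/-- The (closed) normal cone of `Q` at `v`: the functionals that attain their maximum over `Q`
at `v`. -/
def normalCone {n : ℕ} (Q : Set (Fin n → ℝ)) (v : Fin n → ℝ) : Set (Fin n → ℝ) :=
  {f | ∀ x ∈ Q, ∑ i, f i * x i ≤ ∑ i, f i * v i}

/-- `f : [n] → {1, 2, …}` is `Q`-generic if it lies in the interior of the normal cone of `Q` at
some vertex of `Q`. -/
def IsGeneric {n : ℕ} (Q : Set (Fin n → ℝ)) (f : Fin n → ℕ+) : Prop :=
  ∃ v ∈ Set.extremePoints ℝ Q, (fun i => ((f i : ℕ) : ℝ)) ∈ interior (normalCone Q v)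

/-- `F(Q) = ∑ x_f`, the sum over all `Q`-generic functions `f`. -/
noncomputable def polytopeEnumerator {n : ℕ} (Q : Set (Fin n → ℝ)) : MvPowerSeries ℕ+ ℤ :=
  enumerator {f | IsGeneric Q f}

/-! ### Building sets and nestohedra -/

/-- `B` is a building set on `[n]`. -/
structure IsBuildingSet {n : ℕ} (B : Finset (Finset (Fin n))) : Prop where
  nonempty_of_mem : ∀ I ∈ B, I.Nonempty
  singleton_mem : ∀ i : Fin n, {i} ∈ B
  union_mem : ∀ I ∈ B, ∀ J ∈ B, (I ∩ J).Nonempty → I ∪ J ∈ B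

/-- A building set on `[n]` is connected if `[n]` belongs to it. -/
def IsConnected {n : ℕ} (B : Finset (Finset (Fin n))) : Prop := Finset.univ ∈ B

/-- The face `Conv {e_i | i ∈ I}` of the standard coordinate simplex. -/
noncomputable def simplexFace {n : ℕ} (I : Finset (Fin n)) : Set (Fin n → ℝ) :=
  convexHull ℝ ((fun i => (Pi.single i 1 : Fin n → ℝ)) '' (I : Set (Fin n)))

/-- The polytope `P_B`, the Minkowski sum of the simplices `Conv {e_i | i ∈ I}`, `I ∈ B`. -/
noncomputable def nestohedron {n : ℕ} (B : Finset (Finset (Fin n))) : Set (Fin n → ℝ) :=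
  ∑ I ∈ B, simplexFace I

theorem finite_vertices {n : ℕ} (B : Finset (Finset (Fin n))) :
    (Set.extremePoints ℝ (nestohedron B)).Finite := by
  classical
  unfold nestohedron simplexFace
  rw [← convexHull_sum]
  refine Set.Finite.subset ?_ extremePoints_convexHull_subset
  induction B using Finset.induction_on with
  | empty => simp
  | insert I B hI ih =>
    rw [Finset.sum_insert hI]
    exact ((I.finite_toSet).image _).add ih

/-- The vertices of `P_B`. -/
noncomputable def vertices {n : ℕ} (B : Finset (Finset (Fin n))) : Finset (Fin n → ℝ) :=
  (finite_vertices B).toFinset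

/-- The inclusion-maximal elements of `B`; this is `{[n]}` if `B` is connected. -/
noncomputable def maxElements {n : ℕ} (B : Finset (Finset (Fin n))) :
    Finset (Finset (Fin n)) :=
  B.filter fun I => ∀ J ∈ B, I ⊆ J → J = I

/-- `μ(B|_I)`, the number of elements of `B` contained in `I`. -/
def mu {n : ℕ} (B : Finset (Finset (Fin n))) (I : Finset (Fin n)) : ℕ :=
  (B.filter fun J => J ⊆ I).card

/-- The facet `F_I` of `P_B`, cut out by the hyperplane `∑_{i ∈ I} x_i = μ(B|_I)`. -/
def facet {n : ℕ} (B : Finset (Finset (Fin n))) (I : Finset (Fin n)) : Set (Fin n → ℝ) :=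
  {x | x ∈ nestohedron B ∧ ∑ i ∈ I, x i = (mu B I : ℝ)}

/-- Nested sets of `B`: conditions (N1) and (N2). -/
structure IsNested {n : ℕ} (B N : Finset (Finset (Fin n))) : Prop where
  subset : N ⊆ B \ maxElements B
  laminar : ∀ I ∈ N, ∀ J ∈ N, I ⊆ J ∨ J ⊆ I ∨ Disjoint I J
  union_notMem : ∀ S ⊆ N, 2 ≤ S.card → (S : Set (Finset (Fin n))).PairwiseDisjoint id →
    S.sup id ∉ B

/-- Maximal nested sets of `B`. -/
def IsMaximalNested {n : ℕ} (B N : Finset (Finset (Fin n))) : Prop :=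
  Maximal (IsNested B) N

open Classical in
/-- The nested set `N_v` of a vertex `v`: the (indices of the) facets of `P_B` that contain `v`. -/
noncomputable def nestedSetAt {n : ℕ} (B : Finset (Finset (Fin n))) (v : Fin n → ℝ) :
    Finset (Finset (Fin n)) :=
  (B \ maxElements B).filter fun I => v ∈ facet B I

/-- `i = i_I`, that is `{i} = I \ ⋃ {J ∈ N | J ⊊ I}`. -/
def IsTop {n : ℕ} (N : Finset (Finset (Fin n))) (I : Finset (Fin n)) (i : Fin n) : Prop :=
  I \ (N.filter fun J => J ⊂ I).sup id = {i}

/-- The order `≤_v` of the poset `P_v` on `[n]`: `i_I ≤_v i_J` iff `I ⊆ J`, for `I`, `J` in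
`N_v ∪ B_max`, which is `N_v ∪ {[n]}` if `B` is connected. -/
def posetLE {n : ℕ} (B : Finset (Finset (Fin n))) (v : Fin n → ℝ) (i j : Fin n) : Prop :=
  ∃ I ∈ nestedSetAt B v ∪ maxElements B, ∃ J ∈ nestedSetAt B v ∪ maxElements B,
    IsTop (nestedSetAt B v) I i ∧ IsTop (nestedSetAt B v) J j ∧ I ⊆ J

/-! ### Trees and their partition enumerators -/

/-- The Hasse diagram of an order relation, an edge `i → j` for each covering relation `i ⋖ j`. -/
def hasseDigraph {V : Type*} (le : V → V → Prop) : Digraph V where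
  Adj i j := le i j ∧ i ≠ j ∧ ∀ k, le i k → le k j → k = i ∨ k = j

/-- The `B`-tree `T_v`, with vertex set `[n]`. -/
def bTree {n : ℕ} (B : Finset (Finset (Fin n))) (v : Fin n → ℝ) : Digraph (Fin n) :=
  hasseDigraph (posetLE B v)

/-- A finite digraph is a rooted forest, with edges directed towards the roots, if it has no
directed cycle and at most one edge leaves each vertex. -/
def IsRootedForest {V : Type*} (T : Digraph V) : Prop :=
  (∀ i j k, T.Adj i j → T.Adj i k → j = k) ∧ ∀ i, ¬ Relation.TransGen T.Adj i i

/-- A rooted tree, with edges directed towards the root `r`. -/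
def IsRootedTree {V : Type*} (T : Digraph V) : Prop :=
  IsRootedForest T ∧ ∃ r, ∀ i, Relation.ReflTransGen T.Adj i r

/-- `f` is a `T`-partition: `f i < f j` for each edge `i → j`. -/
def IsTreePartition {V : Type*} (T : Digraph V) (f : V → ℕ+) : Prop :=
  ∀ i j, T.Adj i j → f i < f j

/-- `F(T) = ∑ x_f`, the sum over all `T`-partitions `f`. -/
noncomputable def treeEnumerator {V : Type*} [Fintype V] (T : Digraph V) :
    MvPowerSeries ℕ+ ℤ :=
  enumerator {f | IsTreePartition T f}

/-- `F(T)` depends only on the isomorphism class of `T`. -/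
theorem treeEnumerator_congr {V W : Type*} [Fintype V] [Fintype W] (T : Digraph V)
    (U : Digraph W) (e : T.Adj ≃r U.Adj) : treeEnumerator T = treeEnumerator U := by
  funext d
  unfold treeEnumerator enumerator
  have hexpo : ∀ g : W → ℕ+, expo (g ∘ e) = expo g := fun g =>
    e.toEquiv.sum_comp (fun w => (Finsupp.single (g w) 1 : ℕ+ →₀ ℕ))
  have hpart : ∀ g : W → ℕ+, IsTreePartition T (g ∘ e) ↔ IsTreePartition U g := by
    intro g
    constructor
    · intro h i j hij
      have := h (e.symm i) (e.symm j) (e.symm.map_rel_iff.2 hij)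
      simpa using this
    · intro h i j hij
      exact h _ _ (e.map_rel_iff.2 hij)
  congr 1
  refine (Set.ncard_congr (fun g _ => g ∘ e) ?_ ?_ ?_).symm
  · rintro g ⟨hg, hd⟩
    exact ⟨(hpart g).2 hg, (hexpo g).trans hd⟩
  · intro g h _ _ hgh
    funext w
    have := congrFun hgh (e.symm w)
    simpa using this
  · rintro f ⟨hf, hd⟩
    have hfe : (f ∘ e.symm) ∘ e = f := by
      funext v
      simp
    refine ⟨f ∘ e.symm, ⟨(hpart _).1 ?_, (hexpo _).symm.trans ?_⟩, hfe⟩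
    · rw [hfe]
      exact hf
    · rw [hfe]
      exact hd

/-- Isomorphism of finite digraphs. -/
def digraphSetoid : Setoid (Σ n : ℕ, Digraph (Fin n)) where
  r T U := Nonempty (T.2.Adj ≃r U.2.Adj)
  iseqv :=
    { refl := fun T => ⟨RelIso.refl T.2.Adj⟩
      symm := fun ⟨e⟩ => ⟨e.symm⟩
      trans := fun ⟨e⟩ ⟨e'⟩ => ⟨e.trans e'⟩ }

/-- Unlabelled finite digraphs, that is isomorphism classes of finite digraphs; unlabelled rooted
trees and forests are particular ones. -/
def Unlabelled : Type := Quotient digraphSetoid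

/-- The isomorphism class of a digraph. -/
def toUnlabelled {n : ℕ} (T : Digraph (Fin n)) : Unlabelled := Quotient.mk digraphSetoid ⟨n, T⟩

/-- The enumerator `F(T)` of an unlabelled `T`. -/
noncomputable def unlabelledEnumerator : Unlabelled → MvPowerSeries ℕ+ ℤ :=
  Quotient.lift (fun T => treeEnumerator T.2) fun T U ⟨e⟩ => treeEnumerator_congr T.2 U.2 e

/-- `T(B)`: the multiset of the unlabelled `B`-trees `T_v`, `v` running over the vertices
of `P_B`. -/
noncomputable def bTrees {n : ℕ} (B : Finset (Finset (Fin n))) : Multiset Unlabelled :=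
  (vertices B).val.map fun v => toUnlabelled (bTree B v)

end Nestohedra

namespace Nestohedra

open scoped Classical

/-! ### Strict maxima of functionals -/

variable {n : ℕ}

/-! A vertex `v` of the Minkowski sum is the unique maximizer of some functional `f`, so `f` has a
strict maximum on every `J ∈ B` and `v` is the sum of the corresponding `e_i`. The open normal cone
at `v` consists of the `g` with the same argmaxes (`mem_interior_normalCone_iff`). Let `U_i` be
`argmaxUnion B f i`, the largest member of `B` with argmax `i`. The union axiom makes the `U_i` a
laminar family, and counting argmaxes shows that the facets through `v` are indexed by the
nonmaximal `U_i` (`mem_facet_iff_exists`). Hence `N_v ∪ B_max` is the set of all `U_i`, the top of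
`U_i` is `i`, and `i ≤_v j` means `i ∈ U_j` (`posetLE_iff`). The cone inequalities then say exactly
that `g` is strictly increasing on `P_v`, that is, a `T_v`-partition. Open cones of distinct
vertices are disjoint, so the enumerators add up. -/

/-- `i` is the unique element of `J` at which `f` is maximal. -/
def IsStrictArgmax (f : Fin n → ℝ) (J : Finset (Fin n)) (i : Fin n) : Prop :=
  i ∈ J ∧ ∀ k ∈ J, k ≠ i → f k < f i

theorem IsStrictArgmax.unique {f : Fin n → ℝ} {J : Finset (Fin n)} {i j : Fin n}
    (hi : IsStrictArgmax f J i) (hj : IsStrictArgmax f J j) : i = j := by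
  by_contra h
  exact lt_asymm (hi.2 j hj.1 (Ne.symm h)) (hj.2 i hi.1 h)

theorem IsStrictArgmax.le {f : Fin n → ℝ} {J : Finset (Fin n)} {i k : Fin n}
    (hi : IsStrictArgmax f J i) (hk : k ∈ J) : f k ≤ f i := by
  by_cases h : k = i
  · rw [h]
  · exact (hi.2 k hk h).le

/-- The vertices of the simplices `Conv {e_i | i ∈ J}`, `J ∈ B`, at which `f` is maximal are
unique, and `v` is their sum. -/
def IsStrictMaximizer (B : Finset (Finset (Fin n))) (f v : Fin n → ℝ) : Prop :=
  ∃ p : Finset (Fin n) → Fin n → ℝ,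
    (∀ J ∈ B, ∃ i, IsStrictArgmax f J i ∧ p J = Pi.single i 1) ∧ ∑ J ∈ B, p J = v

theorem IsStrictMaximizer.unique {B : Finset (Finset (Fin n))} {f v w : Fin n → ℝ}
    (hv : IsStrictMaximizer B f v) (hw : IsStrictMaximizer B f w) : v = w := by
  obtain ⟨p, hp, rfl⟩ := hv
  obtain ⟨q, hq, rfl⟩ := hw
  refine Finset.sum_congr rfl fun J hJ => ?_
  obtain ⟨i, hi, hpi⟩ := hp J hJ
  obtain ⟨j, hj, hqj⟩ := hq J hJ
  rw [hpi, hqj, hi.unique hj]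

theorem IsStrictMaximizer.exists_argmax {B : Finset (Finset (Fin n))} {f v : Fin n → ℝ}
    (hv : IsStrictMaximizer B f v) : ∀ J ∈ B, ∃ i, IsStrictArgmax f J i := by
  obtain ⟨p, hp, -⟩ := hv
  exact fun J hJ => (hp J hJ).imp fun i hi => hi.1

/-- A functional with the same strict maxima as `f` has the same maximizer. -/
theorem IsStrictMaximizer.congr {B : Finset (Finset (Fin n))} {f g v : Fin n → ℝ}
    (hv : IsStrictMaximizer B f v)
    (h : ∀ J ∈ B, ∀ i, IsStrictArgmax f J i → IsStrictArgmax g J i) :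
    IsStrictMaximizer B g v := by
  obtain ⟨p, hp, hs⟩ := hv
  refine ⟨p, fun J hJ => ?_, hs⟩
  obtain ⟨i, hi, hpi⟩ := hp J hJ
  exact ⟨i, h J hJ i hi, hpi⟩

/-! ### Vertices and normal cones -/

/-- Exchanging one summand yields the test points that turn optimality of a sum into optimality in
each summand. -/
theorem sum_exchange_mem {ι E : Type*} [AddCommGroup E] {B : Finset ι} {s : ι → Set E}
    {p : ι → E} (hp : ∀ K ∈ B, p K ∈ s K) {J : ι} (hJ : J ∈ B) {q : E} (hq : q ∈ s J) :
    ∑ K ∈ B, p K + (q - p J) ∈ ∑ K ∈ B, s K := by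
  rw [Set.mem_finsetSum]
  refine ⟨Function.update p J q, ?_, ?_⟩
  · intro K hK
    by_cases h : K = J
    · subst h
      simpa using hq
    · simpa [h] using hp K hK
  · rw [Finset.sum_update_of_mem hJ, ← Finset.sum_sdiff (Finset.singleton_subset_iff.2 hJ),
      Finset.sum_singleton]
    abel

theorem single_mem_simplexFace {J : Finset (Fin n)} {i : Fin n} (hi : i ∈ J) :
    (Pi.single i 1 : Fin n → ℝ) ∈ simplexFace J :=
  subset_convexHull ℝ _ ⟨i, hi, rfl⟩

theorem sum_mul_le_of_mem_simplexFace {J : Finset (Fin n)} {g x : Fin n → ℝ} {i : Fin n}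
    (hi : ∀ k ∈ J, g k ≤ g i) (hx : x ∈ simplexFace J) : ∑ k, g k * x k ≤ g i := by
  have hlin : IsLinearMap ℝ fun x : Fin n → ℝ => ∑ k, g k * x k :=
    ⟨fun x y => by simp [mul_add, Finset.sum_add_distrib],
      fun c x => by simp [Finset.mul_sum, mul_left_comm]⟩
  refine convexHull_min ?_ (convex_halfSpace_le hlin (g i)) hx
  rintro _ ⟨k, hk, rfl⟩
  simpa [Pi.single_apply] using hi k hk

/-- Every vertex of `P_B` is the strict maximizer of some functional. -/
theorem exists_isStrictMaximizer {B : Finset (Finset (Fin n))} {v : Fin n → ℝ}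
    (hv : v ∈ Set.extremePoints ℝ (nestohedron B)) : ∃ f, IsStrictMaximizer B f v := by
  set E : Finset (Fin n) → Set (Fin n → ℝ) :=
    fun J => (fun i => (Pi.single i 1 : Fin n → ℝ)) '' (J : Set (Fin n)) with hE
  set S : Set (Fin n → ℝ) := ∑ J ∈ B, E J with hS
  have hconv : nestohedron B = convexHull ℝ S := by
    rw [hS, convexHull_sum]; rfl
  have hfin : S.Finite := by
    rw [hS]
    have : ∀ C : Finset (Finset (Fin n)), (∑ J ∈ C, E J).Finite := by
      intro C
      induction C using Finset.induction_on with
      | empty => simp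
      | insert I C hI ih =>
        rw [Finset.sum_insert hI]
        exact ((I.finite_toSet).image _).add ih
    exact this B
  rw [hconv] at hv
  have hvS : v ∈ S := extremePoints_convexHull_subset hv
  -- Extremality keeps `v` out of the hull of `S \ {v}`. That hull is closed because `S` is finite,
  -- so a functional separates `v` from it strictly.
  have hv' := ((convex_convexHull ℝ S).mem_extremePoints_iff_mem_sdiff_convexHull_sdiff.1 hv).2
  have hvn : v ∉ convexHull ℝ (S \ {v}) := fun h =>
    hv' (convexHull_mono (Set.sdiff_subset_sdiff_left (subset_convexHull ℝ S)) h)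
  obtain ⟨l, u, hlu, huv⟩ := geometric_hahn_banach_closed_point (convex_convexHull ℝ _)
    ((hfin.subset Set.sdiff_subset).isClosed_convexHull (𝕜 := ℝ)) hvn
  rw [hS, Set.mem_finsetSum] at hvS
  obtain ⟨p, hp, hpv⟩ := hvS
  refine ⟨fun i => l (Pi.single i 1), p, fun J hJ => ?_, hpv⟩
  obtain ⟨i, hi, hpi⟩ := hp hJ
  refine ⟨i, ⟨hi, fun k hk hki => ?_⟩, hpi.symm⟩
  -- Trading `e_i` for `e_k` in the summand `J` gives a point of `S` other than `v`, where `l` is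
  -- strictly smaller.
  have hx := sum_exchange_mem (fun K hK => hp hK) hJ (q := Pi.single k 1) ⟨k, hk, rfl⟩
  rw [hpv, ← hpi] at hx
  have hne : v + ((Pi.single k 1 : Fin n → ℝ) - Pi.single i 1) ≠ v := by
    intro h
    have := congrFun h k
    simp [hki] at this
  have := (hlu _ (subset_convexHull ℝ _ ⟨hx, hne⟩)).trans huv
  simp only [map_add, map_sub] at this
  linarith

theorem mem_interior_normalCone_iff {B : Finset (Finset (Fin n))} {f v g : Fin n → ℝ}
    (hv : IsStrictMaximizer B f v) :
    g ∈ interior (normalCone (nestohedron B) v) ↔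
      ∀ J ∈ B, ∀ i, IsStrictArgmax f J i → IsStrictArgmax g J i := by
  obtain ⟨p, hp, rfl⟩ := hv
  have hmem : ∀ J ∈ B, p J ∈ simplexFace J := fun J hJ => by
    obtain ⟨i, hi, hpi⟩ := hp J hJ
    rw [hpi]
    exact single_mem_simplexFace hi.1
  constructor
  · intro hg J hJ i hi
    refine ⟨hi.1, fun k hk hki => ?_⟩
    obtain ⟨i', hi', hpi⟩ := hp J hJ
    obtain rfl := hi.unique hi'
    -- Interiority leaves room to raise `g k` by some `t > 0`; the exchange of `e_i` for `e_k` then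
    -- gives `g k + t ≤ g i`.
    have hcont : Continuous fun t : ℝ => g + t • (Pi.single k 1 : Fin n → ℝ) := by fun_prop
    have hev : ∀ᶠ t in nhds (0 : ℝ),
        g + t • (Pi.single k 1 : Fin n → ℝ) ∈ interior (normalCone (nestohedron B) _) :=
      hcont.continuousAt.eventually_mem (isOpen_interior.mem_nhds (by simpa using hg))
    obtain ⟨t, ht, ht0⟩ := ((hev.filter_mono nhdsWithin_le_nhds).and
      (self_mem_nhdsWithin : Set.Ioi (0 : ℝ) ∈ nhdsWithin 0 (Set.Ioi 0))).exists
    have hx := interior_subset ht _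
      (sum_exchange_mem hmem hJ (single_mem_simplexFace hk))
    rw [hpi] at hx
    simp only [Pi.add_apply, Pi.sub_apply, mul_add, mul_sub, Finset.sum_add_distrib,
      Finset.sum_sub_distrib] at hx
    simp [Pi.single_apply, Ne.symm hki] at hx
    have : 0 < t := ht0
    linarith
  · intro hg
    have hopen : IsOpen {g : Fin n → ℝ |
        ∀ J ∈ B, ∀ i, IsStrictArgmax f J i → ∀ k ∈ J, k ≠ i → g k < g i} := by
      simp only [Set.ofPred_forall]
      refine isOpen_biInter_finset fun J _ => isOpen_iInter_of_finite fun i =>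
        isOpen_iInter_of_finite fun _ => isOpen_biInter_finset fun k _ =>
        isOpen_iInter_of_finite fun _ => ?_
      exact isOpen_lt (continuous_apply k) (continuous_apply i)
    refine interior_maximal ?_ hopen fun J hJ i hi => (hg J hJ i hi).2
    intro g hg x hx
    obtain ⟨q, hq, rfl⟩ := (Set.mem_finsetSum _ _ _).1 hx
    simp only [Finset.sum_apply, Finset.mul_sum]
    rw [Finset.sum_comm, Finset.sum_comm (s := Finset.univ)]
    refine Finset.sum_le_sum fun J hJ => ?_
    obtain ⟨i, hi, hpi⟩ := hp J hJ
    have hgi : IsStrictArgmax g J i := ⟨hi.1, hg J hJ i hi⟩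
    refine (sum_mul_le_of_mem_simplexFace (g := g) (fun k hk => hgi.le hk) (hq hJ)).trans_eq ?_
    simp [hpi, Pi.single_apply]

/-- The sum of `v` over `I` counts the `J ∈ B` with argmax in `I`. Each `J ⊆ I` is counted, so the
sum is at least `mu B I`, with equality iff nothing else is counted. -/
theorem mem_facet_iff {B : Finset (Finset (Fin n))} {f v : Fin n → ℝ}
    (hv : IsStrictMaximizer B f v) (I : Finset (Fin n)) :
    v ∈ facet B I ↔ ∀ J ∈ B, ∀ i ∈ I, IsStrictArgmax f J i → J ⊆ I := by
  obtain ⟨p, hp, rfl⟩ := hv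
  have hmem : ∑ J ∈ B, p J ∈ nestohedron B := (Set.mem_finsetSum _ _ _).2 ⟨p, fun {J} hJ => by
    obtain ⟨i, hi, hpi⟩ := hp J hJ
    rw [hpi]
    exact single_mem_simplexFace hi.1, rfl⟩
  have hmu : (mu B I : ℝ) = ∑ J ∈ B, if J ⊆ I then (1 : ℝ) else 0 := by
    simp [mu]
  have hle : ∀ J ∈ B, (if J ⊆ I then (1 : ℝ) else 0) ≤ ∑ i ∈ I, p J i := by
    intro J hJ
    obtain ⟨i, hi, hpi⟩ := hp J hJ
    by_cases h : J ⊆ I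
    · simp [hpi, Pi.single_apply, h, h hi.1]
    · simp only [h, if_false, hpi, Pi.single_apply]
      exact Finset.sum_nonneg fun _ _ => by split_ifs <;> norm_num
  have : (∑ J ∈ B, p J) ∈ facet B I ↔ ∑ J ∈ B, ∑ i ∈ I, p J i = mu B I := by
    simp only [facet, Set.mem_ofPred_eq, hmem, true_and, Finset.sum_apply]
    rw [Finset.sum_comm]
  rw [this, hmu, eq_comm, Finset.sum_eq_sum_iff_of_le hle]
  refine forall₂_congr fun J hJ => ?_
  obtain ⟨i, hi, hpi⟩ := hp J hJ
  have : (∀ j ∈ I, IsStrictArgmax f J j → J ⊆ I) ↔ (i ∈ I → J ⊆ I) :=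
    ⟨fun h hiI => h i hiI hi, fun h j hjI hj => h (hi.unique hj ▸ hjI)⟩
  rw [this]
  by_cases h : J ⊆ I
  · simp [hpi, Pi.single_apply, h, h hi.1]
  · by_cases h' : i ∈ I <;> simp [hpi, Pi.single_apply, h, h']

/-! ### The largest elements of `B` with given maximum -/

/-- The union of the elements of `B` on which `f` has its strict maximum at `i`. -/
noncomputable def argmaxUnion (B : Finset (Finset (Fin n))) (f : Fin n → ℝ) (i : Fin n) :
    Finset (Fin n) :=
  (B.filter fun J => IsStrictArgmax f J i).sup id

section argmaxUnion

variable {B : Finset (Finset (Fin n))} {f v : Fin n → ℝ}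

theorem subset_argmaxUnion {J : Finset (Fin n)} {i : Fin n} (hJ : J ∈ B)
    (h : IsStrictArgmax f J i) : J ⊆ argmaxUnion B f i :=
  Finset.le_sup (f := id) (Finset.mem_filter.2 ⟨hJ, h⟩)

theorem argmaxUnion_mem_and_isStrictArgmax (hB : IsBuildingSet B) (i : Fin n) :
    argmaxUnion B f i ∈ B ∧ IsStrictArgmax f (argmaxUnion B f i) i := by
  have hs : IsStrictArgmax f {i} i := by
    simp [IsStrictArgmax]
  unfold argmaxUnion
  -- The family contains `{i}`; with `sup'` the induction avoids the empty union, which is not in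
  -- `B`.
  rw [← Finset.sup'_eq_sup ⟨{i}, Finset.mem_filter.2 ⟨hB.singleton_mem i, hs⟩⟩]
  refine Finset.sup'_induction (p := fun J => J ∈ B ∧ IsStrictArgmax f J i) _ _ ?_ ?_
  · rintro I ⟨hI, hIi⟩ J ⟨hJ, hJi⟩
    refine ⟨hB.union_mem I hI J hJ ⟨i, Finset.mem_inter.2 ⟨hIi.1, hJi.1⟩⟩,
      Finset.mem_union_left _ hIi.1, fun k hk hki => ?_⟩
    rcases Finset.mem_union.1 hk with hk | hk
    · exact hIi.2 k hk hki
    · exact hJi.2 k hk hki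
  · intro J hJ
    exact Finset.mem_filter.1 hJ

theorem argmaxUnion_mem (hB : IsBuildingSet B) (i : Fin n) : argmaxUnion B f i ∈ B :=
  (argmaxUnion_mem_and_isStrictArgmax hB i).1

theorem isStrictArgmax_argmaxUnion (hB : IsBuildingSet B) (i : Fin n) :
    IsStrictArgmax f (argmaxUnion B f i) i :=
  (argmaxUnion_mem_and_isStrictArgmax hB i).2

theorem self_mem_argmaxUnion (hB : IsBuildingSet B) (i : Fin n) : i ∈ argmaxUnion B f i :=
  (isStrictArgmax_argmaxUnion hB i).1

theorem argmaxUnion_injective (hB : IsBuildingSet B) : Function.Injective (argmaxUnion B f) := by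
  intro i j h
  have hi := isStrictArgmax_argmaxUnion (f := f) hB i
  rw [h] at hi
  exact hi.unique (isStrictArgmax_argmaxUnion hB j)

/-- The union of `J` and `U_i` is in `B`, and its argmax is `i` since `f ≤ f j ≤ f i` on `J`;
maximality of `U_i` absorbs it. -/
theorem subset_argmaxUnion_of_mem (hB : IsBuildingSet B) (hf : ∀ J ∈ B, ∃ i, IsStrictArgmax f J i)
    {J : Finset (Fin n)} {i j : Fin n} (hJ : J ∈ B) (hj : IsStrictArgmax f J j)
    (hji : j ∈ argmaxUnion B f i) : J ⊆ argmaxUnion B f i := by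
  have hi := isStrictArgmax_argmaxUnion (f := f) hB i
  have hU := hB.union_mem J hJ _ (argmaxUnion_mem (f := f) hB i)
    ⟨j, Finset.mem_inter.2 ⟨hj.1, hji⟩⟩
  obtain ⟨k, hk⟩ := hf _ hU
  have hki : k = i := by
    by_contra hne
    have hlt := hk.2 i (Finset.mem_union_right _ hi.1) (Ne.symm hne)
    rcases Finset.mem_union.1 hk.1 with h | h
    · exact absurd (hlt.trans_le ((hj.le h).trans (hi.le hji))) (lt_irrefl _)
    · exact absurd (hlt.trans_le (hi.le h)) (lt_irrefl _)
  subst hki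
  exact Finset.subset_union_left.trans (subset_argmaxUnion hU hk)

theorem argmaxUnion_subset_iff (hB : IsBuildingSet B) (hf : ∀ J ∈ B, ∃ i, IsStrictArgmax f J i)
    {i j : Fin n} : argmaxUnion B f i ⊆ argmaxUnion B f j ↔ i ∈ argmaxUnion B f j :=
  ⟨fun h => h (self_mem_argmaxUnion hB i), fun h =>
    subset_argmaxUnion_of_mem hB hf (argmaxUnion_mem hB i) (isStrictArgmax_argmaxUnion hB i) h⟩

/-- If the two sets meet, their union is in `B`, and whichever of them contains its argmax absorbs
it. -/
theorem argmaxUnion_laminar (hB : IsBuildingSet B) (hf : ∀ J ∈ B, ∃ i, IsStrictArgmax f J i)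
    (i j : Fin n) : argmaxUnion B f i ⊆ argmaxUnion B f j ∨
      argmaxUnion B f j ⊆ argmaxUnion B f i ∨
        Disjoint (argmaxUnion B f i) (argmaxUnion B f j) := by
  by_cases h : Disjoint (argmaxUnion B f i) (argmaxUnion B f j)
  · exact Or.inr (Or.inr h)
  have hU := hB.union_mem _ (argmaxUnion_mem (f := f) hB i) _ (argmaxUnion_mem (f := f) hB j)
    (Finset.not_disjoint_iff_nonempty_inter.1 h)
  obtain ⟨k, hk⟩ := hf _ hU
  rcases Finset.mem_union.1 hk.1 with hki | hkj
  · exact Or.inr (Or.inl (Finset.subset_union_right.trans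
      (subset_argmaxUnion_of_mem hB hf hU hk hki)))
  · exact Or.inl (Finset.subset_union_left.trans
      (subset_argmaxUnion_of_mem hB hf hU hk hkj))

theorem mem_facet_iff_exists (hB : IsBuildingSet B) (hv : IsStrictMaximizer B f v)
    {I : Finset (Fin n)} (hI : I ∈ B) : v ∈ facet B I ↔ ∃ i, argmaxUnion B f i = I := by
  rw [mem_facet_iff hv]
  constructor
  · intro h
    obtain ⟨i, hi⟩ := hv.exists_argmax I hI
    exact ⟨i, (h _ (argmaxUnion_mem hB i) i hi.1 (isStrictArgmax_argmaxUnion hB i)).antisymm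
      (subset_argmaxUnion hI hi)⟩
  · rintro ⟨i, rfl⟩ J hJ j hj hJj
    exact subset_argmaxUnion_of_mem hB hv.exists_argmax hJ hJj hj

theorem exists_argmaxUnion_eq_of_mem_maxElements (hB : IsBuildingSet B)
    (hf : ∀ J ∈ B, ∃ i, IsStrictArgmax f J i) {I : Finset (Fin n)} (hI : I ∈ maxElements B) :
    ∃ i, argmaxUnion B f i = I := by
  obtain ⟨hIB, hmax⟩ := Finset.mem_filter.1 hI
  obtain ⟨i, hi⟩ := hf I hIB
  exact ⟨i, hmax _ (argmaxUnion_mem hB i) (subset_argmaxUnion hIB hi)⟩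

theorem mem_nestedSetAt_iff (hB : IsBuildingSet B) (hv : IsStrictMaximizer B f v)
    {I : Finset (Fin n)} :
    I ∈ nestedSetAt B v ↔ I ∉ maxElements B ∧ ∃ i, argmaxUnion B f i = I := by
  simp only [nestedSetAt, Finset.mem_filter, Finset.mem_sdiff]
  constructor
  · rintro ⟨⟨hI, hm⟩, hF⟩
    exact ⟨hm, (mem_facet_iff_exists hB hv hI).1 hF⟩
  · rintro ⟨hm, i, rfl⟩
    have hI := argmaxUnion_mem (f := f) hB i
    exact ⟨⟨hI, hm⟩, (mem_facet_iff_exists hB hv hI).2 ⟨i, rfl⟩⟩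

theorem mem_nestedSetAt_union_maxElements_iff (hB : IsBuildingSet B)
    (hv : IsStrictMaximizer B f v) {I : Finset (Fin n)} :
    I ∈ nestedSetAt B v ∪ maxElements B ↔ ∃ i, argmaxUnion B f i = I := by
  rw [Finset.mem_union, mem_nestedSetAt_iff hB hv]
  constructor
  · rintro (h | h)
    · exact h.2
    · exact exists_argmaxUnion_eq_of_mem_maxElements hB hv.exists_argmax h
  · intro h
    by_cases hm : I ∈ maxElements B
    · exact Or.inr hm
    · exact Or.inl ⟨hm, h⟩

theorem argmaxUnion_mem_nestedSetAt (hB : IsBuildingSet B) (hv : IsStrictMaximizer B f v)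
    {i k : Fin n} (hk : k ∈ argmaxUnion B f i) (hki : k ≠ i) :
    argmaxUnion B f k ∈ nestedSetAt B v := by
  refine (mem_nestedSetAt_iff hB hv).2 ⟨fun hm => hki ?_, k, rfl⟩
  exact (argmaxUnion_injective hB ((Finset.mem_filter.1 hm).2 _ (argmaxUnion_mem hB i)
    ((argmaxUnion_subset_iff hB hv.exists_argmax).2 hk))).symm

/-! ### The nested set of a vertex -/

/-- A disjoint union lying in `B` would be absorbed by the member containing its argmax, together
with a second, nonempty member disjoint from it. -/
theorem isNested_nestedSetAt (hB : IsBuildingSet B) (hv : IsStrictMaximizer B f v) :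
    IsNested B (nestedSetAt B v) where
  subset := Finset.filter_subset _ _
  laminar I hI J hJ := by
    obtain ⟨-, i, rfl⟩ := (mem_nestedSetAt_iff hB hv).1 hI
    obtain ⟨-, j, rfl⟩ := (mem_nestedSetAt_iff hB hv).1 hJ
    exact argmaxUnion_laminar hB hv.exists_argmax i j
  union_notMem S hS hcard hdisj hU := by
    obtain ⟨k, hk⟩ := hv.exists_argmax _ hU
    obtain ⟨I, hI, hkI⟩ := Finset.mem_sup.1 hk.1
    obtain ⟨-, i, rfl⟩ := (mem_nestedSetAt_iff hB hv).1 (hS hI)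
    obtain ⟨J, hJ, hJI⟩ := Finset.exists_mem_ne (s := S) (by omega) (argmaxUnion B f i)
    have hsub : J ⊆ argmaxUnion B f i :=
      (Finset.le_sup (f := id) hJ).trans
        (subset_argmaxUnion_of_mem hB hv.exists_argmax hU hk hkI)
    obtain ⟨-, j, rfl⟩ := (mem_nestedSetAt_iff hB hv).1 (hS hJ)
    exact Finset.disjoint_left.1 (hdisj hJ hI hJI) (self_mem_argmaxUnion hB j)
      (hsub (self_mem_argmaxUnion hB j))

/-- Let `I` belong to a larger nested set, with argmax `i`. If `I ≠ U_i`, the maximal `U_k` with `k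
∈ U_i \ I`, together with `I`, are pairwise disjoint with union `U_i ∈ B`, which nestedness forbids.
-/
theorem isMaximalNested_nestedSetAt (hB : IsBuildingSet B) (hv : IsStrictMaximizer B f v) :
    IsMaximalNested B (nestedSetAt B v) := by
  refine ⟨isNested_nestedSetAt hB hv, fun N hN hle I hI => ?_⟩
  have hIB := Finset.mem_sdiff.1 (hN.subset hI)
  obtain ⟨i, hi⟩ := hv.exists_argmax I hIB.1
  refine (mem_nestedSetAt_iff hB hv).2 ⟨hIB.2, i, ?_⟩
  have hIsub := subset_argmaxUnion hIB.1 hi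
  by_contra hne
  have hdisjI : ∀ k ∈ argmaxUnion B f i \ I, argmaxUnion B f k ∈ N ∧
      argmaxUnion B f k ⊆ argmaxUnion B f i ∧ Disjoint (argmaxUnion B f k) I := by
    intro k hk
    obtain ⟨hki, hkI⟩ := Finset.mem_sdiff.1 hk
    have hne : k ≠ i := fun h => hkI (h ▸ hi.1)
    have hsub := (argmaxUnion_subset_iff hB hv.exists_argmax).2 hki
    have hkN := hle (argmaxUnion_mem_nestedSetAt hB hv hki hne)
    refine ⟨hkN, hsub, ?_⟩
    -- `U_k ⊆ I` fails because `k ∉ I`; `I ⊆ U_k` would put `i` in `U_k` and force `U_k = U_i`.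
    rcases hN.laminar _ hkN I hI with h | h | h
    · exact absurd (h (self_mem_argmaxUnion hB k)) hkI
    · exact absurd (argmaxUnion_injective hB
        (hsub.antisymm ((argmaxUnion_subset_iff hB hv.exists_argmax).2 (h hi.1)))) hne
    · exact h
  set K : Finset (Finset (Fin n)) := (argmaxUnion B f i \ I).image (argmaxUnion B f) with hK
  set M : Finset (Finset (Fin n)) := K.filter fun X => ∀ Y ∈ K, X ⊆ Y → Y = X with hM
  have hcover : ∀ X ∈ K, ∃ Y ∈ M, X ⊆ Y := by
    intro X hX
    obtain ⟨Y, hXY, hY⟩ := K.exists_le_maximal hX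
    exact ⟨Y, Finset.mem_filter.2 ⟨hY.prop, fun Z hZ hYZ =>
      (hY.le_of_ge hZ hYZ).antisymm hYZ⟩, hXY⟩
  have hMK : ∀ X ∈ M, ∃ k ∈ argmaxUnion B f i \ I, argmaxUnion B f k = X := fun X hX =>
    Finset.mem_image.1 (Finset.mem_filter.1 hX).1
  have hIM : I ∉ M := by
    intro h
    obtain ⟨k, hk, hkI⟩ := hMK I h
    exact (Finset.mem_sdiff.1 hk).2 (hkI ▸ self_mem_argmaxUnion hB k)
  obtain ⟨k, hk⟩ : (argmaxUnion B f i \ I).Nonempty :=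
    Finset.sdiff_nonempty.2 fun h => hne (h.antisymm hIsub)
  obtain ⟨Y, hY, -⟩ := hcover _ (Finset.mem_image_of_mem _ hk)
  refine hN.union_notMem (insert I M) ?_ ?_ ?_ ?_
  · refine Finset.insert_subset hI fun X hX => ?_
    obtain ⟨k, hk, rfl⟩ := hMK X hX
    exact (hdisjI k hk).1
  · rw [Finset.card_insert_of_notMem hIM]
    have := Finset.card_pos.2 ⟨Y, hY⟩
    omega
  · rw [Finset.coe_insert]
    refine Set.PairwiseDisjoint.insert ?_ ?_
    · intro X hX Z hZ hXZ
      have hX' := Finset.mem_filter.1 (Finset.mem_coe.1 hX)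
      have hZ' := Finset.mem_filter.1 (Finset.mem_coe.1 hZ)
      obtain ⟨a, ha, rfl⟩ := hMK X hX
      obtain ⟨b, hb, rfl⟩ := hMK Z hZ
      rcases argmaxUnion_laminar hB hv.exists_argmax a b with h | h | h
      · exact absurd (hX'.2 _ hZ'.1 h).symm hXZ
      · exact absurd (hZ'.2 _ hX'.1 h) hXZ
      · exact h
    · intro X hX _
      obtain ⟨a, ha, rfl⟩ := hMK X hX
      exact (hdisjI a ha).2.2.symm
  · have hsup : (insert I M).sup id = argmaxUnion B f i := by
      refine le_antisymm (Finset.sup_le fun X hX => ?_) fun k hk => ?_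
      · rcases Finset.mem_insert.1 hX with rfl | hX
        · exact hIsub
        · obtain ⟨a, ha, rfl⟩ := hMK X hX
          exact (hdisjI a ha).2.1
      · rw [Finset.mem_sup]
        by_cases hkI : k ∈ I
        · exact ⟨I, Finset.mem_insert_self _ _, hkI⟩
        · obtain ⟨Y, hY, hkY⟩ := hcover _
            (Finset.mem_image_of_mem _ (Finset.mem_sdiff.2 ⟨hk, hkI⟩))
          exact ⟨Y, Finset.mem_insert_of_mem hY, hkY (self_mem_argmaxUnion hB k)⟩
    rw [hsup]
    exact argmaxUnion_mem hB i

/-! ### The poset of a vertex -/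

/-- Any other `k ∈ U_i` is removed by `U_k ⊊ U_i`, while `i` survives because `i ∈ U_j` forces `U_i
⊆ U_j`. -/
theorem isTop_argmaxUnion_iff (hB : IsBuildingSet B) (hv : IsStrictMaximizer B f v)
    {i j : Fin n} : IsTop (nestedSetAt B v) (argmaxUnion B f i) j ↔ j = i := by
  have h : argmaxUnion B f i \
      ((nestedSetAt B v).filter fun J => J ⊂ argmaxUnion B f i).sup id = {i} := by
    ext k
    simp only [Finset.mem_sdiff, Finset.mem_sup, Finset.mem_filter, Finset.mem_singleton, id]
    constructor
    · rintro ⟨hk, hn⟩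
      by_contra hki
      refine hn ⟨_, ⟨argmaxUnion_mem_nestedSetAt hB hv hk hki, ?_⟩, self_mem_argmaxUnion hB k⟩
      exact ((argmaxUnion_subset_iff hB hv.exists_argmax).2 hk).ssubset_of_ne
        fun h => hki (argmaxUnion_injective hB h)
    · rintro rfl
      refine ⟨self_mem_argmaxUnion hB k, ?_⟩
      rintro ⟨J, ⟨hJ, hss⟩, hkJ⟩
      obtain ⟨-, j, rfl⟩ := (mem_nestedSetAt_iff hB hv).1 hJ
      exact hss.2 ((argmaxUnion_subset_iff hB hv.exists_argmax).2 hkJ)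
  unfold IsTop
  rw [h, Finset.singleton_inj, eq_comm]

theorem posetLE_iff (hB : IsBuildingSet B) (hv : IsStrictMaximizer B f v) {i j : Fin n} :
    posetLE B v i j ↔ i ∈ argmaxUnion B f j := by
  rw [← argmaxUnion_subset_iff hB hv.exists_argmax]
  constructor
  · rintro ⟨I, hI, J, hJ, hIi, hJj, hIJ⟩
    obtain ⟨a, rfl⟩ := (mem_nestedSetAt_union_maxElements_iff hB hv).1 hI
    obtain ⟨b, rfl⟩ := (mem_nestedSetAt_union_maxElements_iff hB hv).1 hJ
    rw [isTop_argmaxUnion_iff hB hv] at hIi hJj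
    rwa [hIi, hJj]
  · intro h
    exact ⟨_, (mem_nestedSetAt_union_maxElements_iff hB hv).2 ⟨i, rfl⟩,
      _, (mem_nestedSetAt_union_maxElements_iff hB hv).2 ⟨j, rfl⟩,
      (isTop_argmaxUnion_iff hB hv).2 rfl, (isTop_argmaxUnion_iff hB hv).2 rfl, h⟩

theorem isPartialOrder_posetLE (hB : IsBuildingSet B) (hv : IsStrictMaximizer B f v) :
    IsPartialOrder (Fin n) (posetLE B v) where
  refl i := (posetLE_iff hB hv).2 (self_mem_argmaxUnion hB i)
  trans i j k := by
    simp only [posetLE_iff hB hv, ← argmaxUnion_subset_iff hB hv.exists_argmax]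
    exact Finset.Subset.trans
  antisymm i j := by
    simp only [posetLE_iff hB hv, ← argmaxUnion_subset_iff hB hv.exists_argmax]
    exact fun h h' => argmaxUnion_injective hB (h.antisymm h')

end argmaxUnion

/-! ### Hasse diagrams -/

section Hasse

variable {V : Type*} {le : V → V → Prop}

theorem transGen_hasseDigraph_of_le [Finite V] [IsPartialOrder V le] {i j : V} (h : le i j)
    (hij : i ≠ j) : Relation.TransGen (hasseDigraph le).Adj i j := by
  let _ : PartialOrder V :=
    { le := le
      le_refl := refl_of le
      le_trans := fun _ _ _ => trans_of le
      le_antisymm := fun _ _ => antisymm_of le }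
  have hcov : ∀ a b : V, a ⋖ b → (hasseDigraph le).Adj a b := fun a b hab =>
    ⟨hab.le, hab.ne, fun k hak hkb => hab.eq_or_eq hak hkb⟩
  have := Fintype.ofFinite V
  let _ : LocallyFiniteOrder V := Fintype.toLocallyFiniteOrder
  have hlt : i < j := lt_of_le_of_ne h hij
  exact Relation.TransGen.mono hcov _ _ (transGen_covBy_of_lt hlt)

theorem lt_of_transGen_hasseDigraph [IsPartialOrder V le] {i j : V}
    (h : Relation.TransGen (hasseDigraph le).Adj i j) : le i j ∧ i ≠ j := by
  induction h with
  | single h => exact ⟨h.1, h.2.1⟩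
  | tail _ h ih =>
    refine ⟨trans_of le ih.1 h.1, fun e => ih.2 ?_⟩
    subst e
    exact antisymm_of le ih.1 h.1

theorem isTreePartition_hasseDigraph_iff [Finite V] [IsPartialOrder V le] {f : V → ℕ+} :
    IsTreePartition (hasseDigraph le) f ↔ ∀ i j, le i j → i ≠ j → f i < f j := by
  refine ⟨fun h i j hij hne => ?_, fun h i j hij => h i j hij.1 hij.2.1⟩
  have := transGen_hasseDigraph_of_le hij hne
  induction this with
  | single h' => exact h _ _ h'
  | @tail b c h₁ h₂ ih =>
    obtain ⟨h₃, h₄⟩ := lt_of_transGen_hasseDigraph h₁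
    exact (ih h₃ h₄).trans (h _ _ h₂)

/-- Two covers of one element are comparable, hence equal. -/
theorem isRootedForest_hasseDigraph [IsPartialOrder V le]
    (hle : ∀ i j k, le i j → le i k → le j k ∨ le k j) : IsRootedForest (hasseDigraph le) := by
  refine ⟨fun i j k hj hk => ?_, fun i h => (lt_of_transGen_hasseDigraph h).2 rfl⟩
  rcases hle i j k hj.1 hk.1 with h | h
  · exact (hk.2.2 j hj.1 h).resolve_left (Ne.symm hj.2.1)
  · exact ((hj.2.2 k hk.1 h).resolve_left (Ne.symm hk.2.1)).symm

end Hasse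

/-! ### The trees `T_v` and the normal cones -/

section bTree

variable {B : Finset (Finset (Fin n))} {f v : Fin n → ℝ}

theorem isRootedForest_bTree (hB : IsBuildingSet B) (hv : IsStrictMaximizer B f v) :
    IsRootedForest (bTree B v) := by
  have := isPartialOrder_posetLE hB hv
  refine isRootedForest_hasseDigraph fun i j k hj hk => ?_
  simp only [posetLE_iff hB hv] at hj hk ⊢
  rcases argmaxUnion_laminar hB hv.exists_argmax j k with h | h | h
  · exact Or.inl ((argmaxUnion_subset_iff hB hv.exists_argmax).1 h)
  · exact Or.inr ((argmaxUnion_subset_iff hB hv.exists_argmax).1 h)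
  · exact absurd hk (Finset.disjoint_left.1 h hj)

theorem isRootedTree_bTree (hB : IsBuildingSet B) (hv : IsStrictMaximizer B f v)
    (hc : IsConnected B) : IsRootedTree (bTree B v) := by
  have := isPartialOrder_posetLE hB hv
  refine ⟨isRootedForest_bTree hB hv, ?_⟩
  obtain ⟨r, hr⟩ := hv.exists_argmax _ hc
  refine ⟨r, fun i => ?_⟩
  by_cases hir : i = r
  · rw [hir]
  · exact (transGen_hasseDigraph_of_le ((posetLE_iff hB hv).2
      (subset_argmaxUnion hc hr (Finset.mem_univ i))) hir).to_reflTransGen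

/-- Every `J ∈ B` with argmax `i` lies in `U_i`, so the cone inequalities reduce to those for the
sets `U_i`, which are the strict relations of `P_v`. -/
theorem isTreePartition_bTree_iff (hB : IsBuildingSet B) (hv : IsStrictMaximizer B f v)
    (g : Fin n → ℕ+) : IsTreePartition (bTree B v) g ↔
      (fun i => ((g i : ℕ) : ℝ)) ∈ interior (normalCone (nestohedron B) v) := by
  have := isPartialOrder_posetLE hB hv
  rw [bTree, isTreePartition_hasseDigraph_iff, mem_interior_normalCone_iff hv]
  simp only [posetLE_iff hB hv]
  constructor
  · intro h J hJ i hi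
    refine ⟨hi.1, fun k hk hki => ?_⟩
    have := h k i (subset_argmaxUnion hJ hi hk) hki
    simpa using this
  · intro h i j hij hne
    have := (h _ (argmaxUnion_mem hB j) j (isStrictArgmax_argmaxUnion hB j)).2 i hij hne
    simpa using this

end bTree

/-! ### The enumerators -/

theorem enumerator_biUnion {V ι : Type*} [Fintype V] (s : Finset ι) (S : ι → Set (V → ℕ+))
    (hS : (s : Set ι).PairwiseDisjoint S) :
    enumerator {f | ∃ a ∈ s, f ∈ S a} = ∑ a ∈ s, enumerator (S a) := by
  induction s using Finset.induction_on with
  | empty =>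
    funext d
    simp [enumerator]
    rfl
  | insert a s ha ih =>
    rw [Finset.sum_insert ha, ← ih (hS.subset (by simp))]
    funext d
    change _ = enumerator (S a) d + enumerator {f | ∃ b ∈ s, f ∈ S b} d
    simp only [enumerator]
    rw [← Nat.cast_add, ← Set.ncard_union_eq ?_ ?_ ?_]
    · congr 2
      ext f
      simp only [Finset.mem_insert, exists_eq_or_imp, Set.mem_ofPred_eq, Set.mem_union]
      tauto
    · rw [Set.disjoint_left]
      rintro f ⟨hf, -⟩ ⟨⟨b, hb, hfb⟩, -⟩
      have hab : a ≠ b := fun h => ha (h ▸ hb)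
      exact Set.disjoint_left.1 (hS (Finset.mem_coe.2 (Finset.mem_insert_self _ _))
        (Finset.mem_coe.2 (Finset.mem_insert_of_mem hb)) hab) hf hfb
    -- Finiteness is essential: `ncard` is `0` on infinite sets, so it is additive only on finite
    -- ones.
    · exact (finite_expo_eq d).subset fun f hf => hf.2
    · exact (finite_expo_eq d).subset fun f hf => hf.2

theorem mem_vertices {B : Finset (Finset (Fin n))} {v : Fin n → ℝ} :
    v ∈ vertices B ↔ v ∈ Set.extremePoints ℝ (nestohedron B) :=
  Set.Finite.mem_toFinset _

theorem polytopeEnumerator_nestohedron {B : Finset (Finset (Fin n))} (hB : IsBuildingSet B) :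
    polytopeEnumerator (nestohedron B) = ∑ v ∈ vertices B, treeEnumerator (bTree B v) := by
  have h := enumerator_biUnion (vertices B) (fun v => {g | IsTreePartition (bTree B v) g}) ?_
  · unfold treeEnumerator
    rw [← h, polytopeEnumerator]
    congr 1
    ext g
    simp only [IsGeneric, Set.mem_ofPred_eq, ← mem_vertices]
    refine exists_congr fun v => and_congr_right fun hv => ?_
    obtain ⟨f, hf⟩ := exists_isStrictMaximizer (mem_vertices.1 hv)
    exact (isTreePartition_bTree_iff hB hf g).symm
  · intro v hv w hw hvw
    -- A common `g` would have both `v` and `w` as its strict maximizer.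
    refine Set.disjoint_left.2 fun g hgv hgw => hvw ?_
    obtain ⟨f, hf⟩ := exists_isStrictMaximizer (mem_vertices.1 hv)
    obtain ⟨f', hf'⟩ := exists_isStrictMaximizer (mem_vertices.1 hw)
    have h₁ := (mem_interior_normalCone_iff hf).1 ((isTreePartition_bTree_iff hB hf g).1 hgv)
    have h₂ := (mem_interior_normalCone_iff hf').1 ((isTreePartition_bTree_iff hB hf' g).1 hgw)
    exact (hf.congr h₁).unique (hf'.congr h₂)

theorem polytopeEnumerator_eq_sum_bTrees {B : Finset (Finset (Fin n))} (hB : IsBuildingSet B) :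
    polytopeEnumerator (nestohedron B) = ((bTrees B).map unlabelledEnumerator).sum := by
  rw [polytopeEnumerator_nestohedron hB, bTrees, Multiset.map_map]
  rfl

end Nestohedra

/-! ### The main theorem -/

theorem mainTheorem4 :
    (∀ (n : ℕ) (B : Finset (Finset (Fin n))), Nestohedra.IsBuildingSet B →
      (∀ v ∈ Nestohedra.vertices B,
        Nestohedra.IsMaximalNested B (Nestohedra.nestedSetAt B v) ∧
        IsPartialOrder (Fin n) (Nestohedra.posetLE B v) ∧
        Nestohedra.IsRootedForest (Nestohedra.bTree B v) ∧
        (Nestohedra.IsConnected B → Nestohedra.IsRootedTree (Nestohedra.bTree B v))) ∧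
      Nestohedra.polytopeEnumerator (Nestohedra.nestohedron B) =
        ∑ v ∈ Nestohedra.vertices B, Nestohedra.treeEnumerator (Nestohedra.bTree B v) ∧
      Nestohedra.polytopeEnumerator (Nestohedra.nestohedron B) =
        ((Nestohedra.bTrees B).map Nestohedra.unlabelledEnumerator).sum) ∧
    (∀ (n m : ℕ) (B : Finset (Finset (Fin n))) (C : Finset (Finset (Fin m))),
      Nestohedra.IsBuildingSet B → Nestohedra.IsBuildingSet C →
      Nestohedra.bTrees B = Nestohedra.bTrees C →
      Nestohedra.polytopeEnumerator (Nestohedra.nestohedron B) =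
        Nestohedra.polytopeEnumerator (Nestohedra.nestohedron C)) := by
  refine ⟨fun n B hB => ⟨fun v hv => ?_, Nestohedra.polytopeEnumerator_nestohedron hB,
    Nestohedra.polytopeEnumerator_eq_sum_bTrees hB⟩, fun n m B C hB hC h => ?_⟩
  · obtain ⟨f, hf⟩ := Nestohedra.exists_isStrictMaximizer (Nestohedra.mem_vertices.1 hv)
    exact ⟨Nestohedra.isMaximalNested_nestedSetAt hB hf,
      Nestohedra.isPartialOrder_posetLE hB hf, Nestohedra.isRootedForest_bTree hB hf,
      Nestohedra.isRootedTree_bTree hB hf⟩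
  · rw [Nestohedra.polytopeEnumerator_eq_sum_bTrees hB,
      Nestohedra.polytopeEnumerator_eq_sum_bTrees hC, h]
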